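/- Let $d\in\mathbb N$, $\|\cdot\|$ the Euclidean norm on $\mathbb R^d$, $B_R=\{\theta\in\mathbb R^d:\|\theta\|\le R\}$, $\mathcal P_2(\mathbb R^d)$ the Borel probability measures with finite second moment, and $W_2$ the $2$-Wasserstein distance. For continuous $L,G:\mathbb R^d\to\mathbb R$, parameters $\alpha>0$, $\beta\in(0,1]$, $\delta_q>0$, $R>0$ and $\varrho\in\mathcal P_2(\mathbb R^d)$ let $$q_a[\varrho]=\inf\{q\in\mathbb R: a\le\varrho(\{L\le q\})\},\qquad Q_\beta[\varrho]=\Big\{\theta\in B_R: L(\theta)\le\tfrac2\beta\int_{\beta/2}^{\beta}q_a[\varrho]\,da+\delta_q\Big\},$$ and, if $\varrho(Q_\beta[\varrho])>0$, let the consensus point be $$m^{G,L}_{\alpha,\beta}(\varrho)=\frac{\int_{Q_\beta[\varrho]}\theta\, e^{-\alpha G(\theta)}\,d\varrho(\theta)}{\int_{Q_\beta[\varrho]}e^{-\alpha G(\theta)}\,d\varrho(\theta)} .$$ A probability density is identified with the measure it defines. Assume that for some constants $C_1,C_4>0$ and $C_L$ the functions $L$ and $G$ satisfy: (W1) $\underline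 L:=\inf L>-\infty$; (W2) $|L(\theta)-L(\theta')|\le C_1\|\theta-\theta'\|$ for all $\theta,\theta'\in\mathbb R^d$; (W3) $q\mapsto\mathrm{Vol}(\{\theta\in B_R:L(\theta)\le q\})$ is $C_L$-Lipschitz on $[\underline L,\infty)$; (W4) $\underline G:=\inf G>-\infty$; (W5) either $\sup G<\infty$, or there are $C_2,C_3>0$ with $G(\theta)-\underline G\ge C_2\|\theta\|^2$ whenever $\|\theta\|\ge C_3$; (W6) $G(\theta)-\underline G\le C_4(1+\|\theta\|^2)$ for all $\theta\in\mathbb R^d$. (a) Let $K<\infty$ and $c>0$, and let $\varrho,\tilde\varrho\in L^\infty(\mathbb R^d)$ be densities of measures in $\mathcal P_2(\mathbb R^d)$ with second moments at most $K$, with $\varrho(Q_\beta[\varrho])\ge c$ and $\tilde\varrho(Q_\beta[\tilde\varrho])\ge c$, and with $\|\tilde\varrho\|_{L^\infty}\le\Lambda$. Then $$\big\|m^{G,L}_{\alpha,\beta}(\varrho)-m^{G,L}_{\alpha,\beta}(\tilde\varrho)\big\|\le C\big(\|\varrho-\tilde\varrho\|_{L^2(B_R)}+W_2(\varrho,\tilde\varrho)\big),$$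 where the constant $C>0$ depends only on $d,R,K,c,\alpha,\beta,C_1,C_L,C_4$ and $\Lambda$ (in particular not on $\delta_q$, nor on $L$, $G$, $\varrho$, $\tilde\varrho$ otherwise). (b) No bound by $W_2$ alone can hold for general measures in $\mathcal P_2$: let $d=2$, $L(\theta)=G(\theta)=\|\theta\|$, $\beta=0.3$. For all $\alpha,\delta_q,R>0$ there is no constant $C$ such that $\|m^{G,L}_{\alpha,\beta}(\varrho)-m^{G,L}_{\alpha,\beta}(\tilde\varrho)\|\le C\,W_2(\varrho,\tilde\varrho)$ for all $\varrho,\tilde\varrho\in\mathcal P_2(\mathbb R^2)$ with $\varrho(Q_\beta[\varrho])>0$ and $\tilde\varrho(Q_\beta[\tilde\varrho])>0$. -/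

import Mathlib

open MeasureTheory
open scoped ENNReal

noncomputable section

namespace CB2O

/-- The Euclidean space `ℝ^d`. -/
abbrev Eucl (d : ℕ) : Type := EuclideanSpace ℝ (Fin d)

variable {d : ℕ}

/-- Borel probability measures on `ℝ^d` with finite second moment. -/
structure IsP2 (μ : Measure (Eucl d)) : Prop where
  prob : IsProbabilityMeasure μ
  moment : Integrable (fun θ => ‖θ‖ ^ 2) μ

/-- Couplings of `μ` and `ν`. -/
def couplings (μ ν : Measure (Eucl d)) : Set (Measure (Eucl d × Eucl d)) :=
  {π | IsProbabilityMeasure π ∧ π.map Prod.fst = μ ∧ π.map Prod.snd = ν}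

/-- The Wasserstein-2 distance. On measures with finite second moment the infimum is finite. -/
def wasserstein2 (μ ν : Measure (Eucl d)) : ℝ :=
  Real.sqrt (⨅ π ∈ couplings μ ν, ∫⁻ z, ENNReal.ofReal (‖z.1 - z.2‖ ^ 2) ∂π).toReal

/-- The `a`-quantile of `μ` under `L`. -/
def quantile (L : Eucl d → ℝ) (μ : Measure (Eucl d)) (a : ℝ) : ℝ :=
  sInf {q : ℝ | a ≤ μ.real {θ | L θ ≤ q}}

/-- The regularized quantile set `Q_β[μ]`. -/
def quantileSet (L : Eucl d → ℝ) (β δ R : ℝ) (μ : Measure (Eucl d)) : Set (Eucl d) :=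
  {θ | θ ∈ Metric.closedBall (0 : Eucl d) R ∧
    L θ ≤ 2 / β * (∫ a in (β / 2)..β, quantile L μ a) + δ}

/-- The unnormalized measure `I_β[μ]`. -/
def restrictedMeasure (L : Eucl d → ℝ) (β δ R : ℝ) (μ : Measure (Eucl d)) : Measure (Eucl d) :=
  μ.restrict (quantileSet L β δ R μ)

/-- The Gibbs weight `exp (-α G)`. -/
def gibbsWeight (G : Eucl d → ℝ) (α : ℝ) (θ : Eucl d) : ℝ := Real.exp (-α * G θ)

/-- The consensus point of `μ`: the mean of the Gibbs-weighted, normalized measure `I_β[μ]`. -/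
def consensusPoint (G L : Eucl d → ℝ) (α β δ R : ℝ) (μ : Measure (Eucl d)) : Eucl d :=
  ∫ θ, (gibbsWeight G α θ / ∫ θ', gibbsWeight G α θ' ∂(restrictedMeasure L β δ R μ)) • θ
    ∂(restrictedMeasure L β δ R μ)

/-- The measure with Lebesgue density `ϱ`. -/
def densityMeasure (ϱ : Eucl d → ℝ) : Measure (Eucl d) :=
  volume.withDensity (fun θ => ENNReal.ofReal (ϱ θ))

/-- `ϱ` is the density of a probability measure with finite second moment, and it is essentially
bounded. -/
structure IsBoundedP2Density (ϱ : Eucl d → ℝ) : Prop where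
  nonneg : 0 ≤ᵐ[volume] ϱ
  memLp_top : MemLp ϱ ∞ volume
  isP2 : IsP2 (densityMeasure ϱ)

/-- The `L²` norm over the closed ball of radius `R`. -/
def normL2Ball (R : ℝ) (f : Eucl d → ℝ) : ℝ :=
  (eLpNorm f 2 (volume.restrict (Metric.closedBall (0 : Eucl d) R))).toReal

/-- The assumptions W1 to W6 on the continuous objective functions `L` and `G`, with the constants
that enter the stability estimate made explicit. -/
structure Assumptions (R C₁ C_L C₄ : ℝ) (L G : Eucl d → ℝ) : Prop where
  continuous_L : Continuous L
  continuous_G : Continuous G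
  w1 : BddBelow (Set.range L)
  w2 : ∀ θ θ', |L θ - L θ'| ≤ C₁ * ‖θ - θ'‖
  w3 : ∀ q ∈ Set.Ici (⨅ θ, L θ), ∀ q' ∈ Set.Ici (⨅ θ, L θ),
    |volume.real {θ | θ ∈ Metric.closedBall (0 : Eucl d) R ∧ L θ ≤ q}
      - volume.real {θ | θ ∈ Metric.closedBall (0 : Eucl d) R ∧ L θ ≤ q'}| ≤ C_L * |q - q'|
  w4 : BddBelow (Set.range G)
  w5 : BddAbove (Set.range G) ∨
    ∃ C₂ > 0, ∃ C₃ > 0, ∀ θ, C₃ ≤ ‖θ‖ → C₂ * ‖θ‖ ^ 2 ≤ G θ - ⨅ θ', G θ'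
  w6 : ∀ θ, G θ - ⨅ θ', G θ' ≤ C₄ * (1 + ‖θ‖ ^ 2)

end CB2O

end

noncomputable section

namespace CB2O

open Set Filter Topology

/-! Stability: the consensus point is a quotient of integrals of `w • θ` and `w` over the quantile
set, where `w` is the Gibbs weight. Replacing one density by the other costs their `L¹` distance on
the ball, hence the `L²` norm; replacing one quantile set by the other costs `Λ` times the volume of
the symmetric difference (`norm_setIntegral_sub_setIntegral_le`). Both sets are sublevel sets of `L`
in the same ball, so they are nested and W3 bounds that volume by the distance of the two
thresholds. The denominators are bounded below through the mass `c` and W6.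

The thresholds are compared in `abs_threshold_sub_le`. An upper-tail integral of the quantile
function is the minimum over `t` of `(1 - b) * t + ∫ max (L - t) 0` (the variational formula for the
conditional value at risk). For each `t` this changes by at most `∫ |L z.1 - L z.2|` under any
coupling, and so does the minimum; the average over `[β/2, β]` is a difference of two tails.

Failure for `W₂` alone: a heavy far atom raises the threshold so much that the quantile set is the
whole ball. Moving a light atom across the sphere of radius `R` costs arbitrarily little in `W₂`,
but the consensus point jumps by a fixed amount. -/

/-! ### Quantile functions and the law of `L`. -/

/-- Right continuity of the distribution function makes the infimum attained. The bounds `0 < a` and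
`a < 1` make the set bounded below and nonempty, so `sInf` does not take its default value. -/
theorem quantile_le_iff {d : ℕ} {L : Eucl d → ℝ} (hL : Measurable L)
    (hb : BddBelow (range L)) (μ : Measure (Eucl d)) [IsProbabilityMeasure μ]
    {a : ℝ} (ha : a ∈ Ioo (0 : ℝ) 1) (t : ℝ) :
    quantile L μ a ≤ t ↔ a ≤ μ.real {θ | L θ ≤ t} := by
  have hF : ∀ q, μ.real {θ | L θ ≤ q} = ProbabilityTheory.cdf (μ.map L) q := by
    intro q
    have : IsProbabilityMeasure (μ.map L) := Measure.isProbabilityMeasure_map hL.aemeasurable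
    rw [ProbabilityTheory.cdf_eq_real, map_measureReal_apply hL measurableSet_Iic]
    rfl
  have : IsProbabilityMeasure (μ.map L) := Measure.isProbabilityMeasure_map hL.aemeasurable
  set F := ProbabilityTheory.cdf (μ.map L) with hFdef
  have hbdd : BddBelow {q : ℝ | a ≤ F q} := by
    obtain ⟨m, hm⟩ := hb
    refine ⟨m, fun q hq => ?_⟩
    by_contra! hlt
    have : {θ | L θ ≤ q} = ∅ := by
      ext θ
      have := hm (mem_range_self θ)
      simp only [mem_ofPred_eq, mem_empty_iff_false, iff_false, not_le]
      linarith
    have h0 := hF q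
    rw [this, measureReal_empty] at h0
    rw [mem_ofPred_eq, ← h0] at hq
    linarith [ha.1]
  have hne : {q : ℝ | a ≤ F q}.Nonempty := by
    have h1 := (ProbabilityTheory.tendsto_cdf_atTop (μ.map L)).eventually_const_lt ha.2
    obtain ⟨q, hq⟩ := h1.exists
    exact ⟨q, hq.le⟩
  simp only [quantile, hF]
  constructor
  · intro h
    have hr : Tendsto F (𝓝[>] t) (𝓝 (F t)) :=
      (F.right_continuous t).mono_left (nhdsWithin_mono _ Ioi_subset_Ici_self)
    refine ge_of_tendsto hr ?_
    filter_upwards [self_mem_nhdsWithin] with s hs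
    obtain ⟨q, hq, hqs⟩ := exists_lt_of_csInf_lt hne (lt_of_le_of_lt h hs)
    exact le_trans hq (F.mono hqs.le)
  · intro h
    exact csInf_le hbdd h

theorem monotoneOn_quantile {d : ℕ} {L : Eucl d → ℝ} (hL : Measurable L)
    (hb : BddBelow (range L)) (μ : Measure (Eucl d)) [IsProbabilityMeasure μ] :
    MonotoneOn (quantile L μ) (Ioo 0 1) := fun _ ha _ hb' hab =>
  (quantile_le_iff hL hb μ ha _).2 (hab.trans ((quantile_le_iff hL hb μ hb' _).1 le_rfl))

theorem aemeasurable_quantile {d : ℕ} {L : Eucl d → ℝ} (hL : Measurable L)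
    (hb : BddBelow (range L)) (μ : Measure (Eucl d)) [IsProbabilityMeasure μ] :
    AEMeasurable (quantile L μ) (volume.restrict (Ioo 0 1)) :=
  aemeasurable_restrict_of_monotoneOn measurableSet_Ioo (monotoneOn_quantile hL hb μ)

/-- Inverse transform sampling: by `quantile_le_iff` the preimage of a half-line is, up to
endpoints, an interval whose length is the distribution function. -/
theorem map_quantile {d : ℕ} {L : Eucl d → ℝ} (hL : Measurable L)
    (hb : BddBelow (range L)) (μ : Measure (Eucl d)) [IsProbabilityMeasure μ] :
    (volume.restrict (Ioo (0 : ℝ) 1)).map (quantile L μ) = μ.map L := by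
  have : IsProbabilityMeasure (μ.map L) := Measure.isProbabilityMeasure_map hL.aemeasurable
  refine Measure.ext_of_Iic _ _ fun t => ?_
  rw [Measure.map_apply_of_aemeasurable (aemeasurable_quantile hL hb μ) measurableSet_Iic,
    Measure.map_apply hL measurableSet_Iic, Measure.restrict_apply' measurableSet_Ioo]
  have hset : quantile L μ ⁻¹' Iic t ∩ Ioo 0 1
      = {a | a ≤ μ.real {θ | L θ ≤ t}} ∩ Ioo 0 1 := by
    ext a
    simp only [mem_inter_iff, mem_preimage, mem_Iic, mem_ofPred_eq, and_congr_left_iff]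
    exact fun ha => quantile_le_iff hL hb μ ha t
  have hval : μ (L ⁻¹' Iic t) = ENNReal.ofReal (μ.real {θ | L θ ≤ t} - 0) := by
    rw [sub_zero, ofReal_measureReal]
    rfl
  have h1 : μ.real {θ | L θ ≤ t} ≤ 1 := measureReal_le_one
  rw [hset, hval]
  refine le_antisymm ?_ ?_
  · rw [← Real.volume_Ioc]
    exact measure_mono fun a ha => ⟨ha.2.1, ha.1⟩
  · rw [← Real.volume_Ioo]
    exact measure_mono fun a ha => ⟨ha.2.le, ha.1, ha.2.trans_le h1⟩

theorem integral_comp_quantile {d : ℕ} {L : Eucl d → ℝ} (hL : Measurable L)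
    (hb : BddBelow (range L)) (μ : Measure (Eucl d)) [IsProbabilityMeasure μ]
    {f : ℝ → ℝ} (hf : Measurable f) :
    ∫ a in Ioo (0 : ℝ) 1, f (quantile L μ a) = ∫ θ, f (L θ) ∂μ := by
  rw [← integral_map (aemeasurable_quantile hL hb μ) hf.aestronglyMeasurable,
    map_quantile hL hb μ, integral_map hL.aemeasurable hf.aestronglyMeasurable]

theorem integrableOn_quantile {d : ℕ} {L : Eucl d → ℝ} (hL : Measurable L)
    (hb : BddBelow (range L)) (μ : Measure (Eucl d)) [IsProbabilityMeasure μ]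
    (hi : Integrable L μ) : IntegrableOn (quantile L μ) (Ioo 0 1) := by
  have h := (integrable_map_measure (f := L) (g := id) aestronglyMeasurable_id
    hL.aemeasurable (μ := μ)).2 hi
  rw [← map_quantile hL hb μ] at h
  exact (integrable_map_measure aestronglyMeasurable_id (aemeasurable_quantile hL hb μ)).1 h

theorem intervalIntegrable_quantile {d : ℕ} {L : Eucl d → ℝ} (hL : Measurable L)
    (hb : BddBelow (range L)) (μ : Measure (Eucl d)) [IsProbabilityMeasure μ]
    (hi : Integrable L μ) {a b : ℝ} (ha : 0 ≤ a) (hab : a ≤ b) (hb1 : b ≤ 1) :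
    IntervalIntegrable (quantile L μ) volume a b := by
  rw [intervalIntegrable_iff_integrableOn_Ioo_of_le hab]
  exact (integrableOn_quantile hL hb μ hi).mono_set (Ioo_subset_Ioo ha hb1)

/-! ### Variational formula for upper tails and its stability under couplings. -/

theorem integral_Ioo_quantile_le {d : ℕ} {L : Eucl d → ℝ} (hL : Measurable L)
    (hb : BddBelow (range L)) (μ : Measure (Eucl d)) [IsProbabilityMeasure μ]
    (hi : Integrable L μ) {b : ℝ} (h0 : 0 < b) (h1 : b < 1) (t : ℝ) :
    ∫ a in Ioo b 1, quantile L μ a ≤ (1 - b) * t + ∫ θ, max (L θ - t) 0 ∂μ := by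
  have hq := integrableOn_quantile hL hb μ hi
  have hsub : Ioo b 1 ⊆ Ioo (0 : ℝ) 1 := Ioo_subset_Ioo h0.le le_rfl
  have hc : IntegrableOn (fun _ : ℝ => t) (Ioo (0 : ℝ) 1) := integrableOn_const (by simp)
  have hm : IntegrableOn (fun a => max (quantile L μ a - t) 0) (Ioo (0 : ℝ) 1) :=
    (hq.sub hc).pos_part
  rw [← integral_comp_quantile hL hb μ (f := fun x => max (x - t) 0) (by fun_prop)]
  have e1 : ∫ a in Ioo b 1, (quantile L μ a - t)
      = (∫ a in Ioo b 1, quantile L μ a) - (1 - b) * t := by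
    rw [integral_sub (hq.mono_set hsub) (hc.mono_set hsub), setIntegral_const]
    simp [h1.le]
  have e2 : ∫ a in Ioo b 1, (quantile L μ a - t)
      ≤ ∫ a in Ioo b 1, max (quantile L μ a - t) 0 :=
    integral_mono ((hq.sub hc).mono_set hsub) (hm.mono_set hsub) fun a => le_max_left _ _
  have e3 : ∫ a in Ioo b 1, max (quantile L μ a - t) 0
      ≤ ∫ a in Ioo 0 1, max (quantile L μ a - t) 0 :=
    setIntegral_mono_set hm (ae_of_all _ fun a => le_max_right _ _) hsub.eventuallyLE
  linarith

/-- The choice `t = quantile L μ b` is optimal in `integral_Ioo_quantile_le`: by monotonicity the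
integrand `quantile - t` is nonnegative above `b`, and its positive part vanishes below. -/
theorem integral_Ioo_quantile_eq {d : ℕ} {L : Eucl d → ℝ} (hL : Measurable L)
    (hb : BddBelow (range L)) (μ : Measure (Eucl d)) [IsProbabilityMeasure μ]
    (hi : Integrable L μ) {b : ℝ} (h0 : 0 < b) (h1 : b < 1) :
    ∫ a in Ioo b 1, quantile L μ a
      = (1 - b) * quantile L μ b + ∫ θ, max (L θ - quantile L μ b) 0 ∂μ := by
  set t := quantile L μ b
  have hq := integrableOn_quantile hL hb μ hi
  have hmono := monotoneOn_quantile hL hb μ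
  have hsub : Ioo b 1 ⊆ Ioo (0 : ℝ) 1 := Ioo_subset_Ioo h0.le le_rfl
  have hc : IntegrableOn (fun _ : ℝ => t) (Ioo (0 : ℝ) 1) := integrableOn_const (by simp)
  rw [← integral_comp_quantile hL hb μ (f := fun x => max (x - t) 0) (by fun_prop)]
  have e1 : ∫ a in Ioo b 1, (quantile L μ a - t)
      = (∫ a in Ioo b 1, quantile L μ a) - (1 - b) * t := by
    rw [integral_sub (hq.mono_set hsub) (hc.mono_set hsub), setIntegral_const]
    simp [h1.le]
  have e2 : ∫ a in Ioo b 1, max (quantile L μ a - t) 0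
      = ∫ a in Ioo b 1, (quantile L μ a - t) :=
    setIntegral_congr_fun measurableSet_Ioo fun a ha =>
      max_eq_left (sub_nonneg.2 (hmono ⟨h0, h1⟩ (hsub ha) ha.1.le))
  have e3 : ∫ a in Ioo 0 1, max (quantile L μ a - t) 0
      = ∫ a in Ioo b 1, max (quantile L μ a - t) 0 := by
    refine setIntegral_eq_of_subset_of_forall_sdiff_eq_zero measurableSet_Ioo hsub ?_
    intro a ha
    refine max_eq_right (sub_nonpos.2 (hmono ha.1 ⟨h0, h1⟩ ?_))
    by_contra! hlt
    exact ha.2 ⟨hlt, ha.1.2⟩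
  linarith

/-- The optimal `t` for one measure is a competitor for the other, and `x ↦ max (x - t) 0` is
1-Lipschitz. The endpoint `b = 1` is needed when `β = 1`. -/
theorem integral_Ioo_quantile_sub_le {d : ℕ} {L : Eucl d → ℝ} (hL : Measurable L)
    (hb : BddBelow (range L)) {μ ν : Measure (Eucl d)} [IsProbabilityMeasure μ]
    [IsProbabilityMeasure ν] (hμ : Integrable L μ) (hν : Integrable L ν)
    {π : Measure (Eucl d × Eucl d)} (hπ : π ∈ couplings μ ν) {b : ℝ} (h0 : 0 < b) (h1 : b ≤ 1) :
    |(∫ a in Ioo b 1, quantile L μ a) - ∫ a in Ioo b 1, quantile L ν a|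
      ≤ ∫ z, |L z.1 - L z.2| ∂π := by
  rcases h1.eq_or_lt with rfl | h1
  · simpa using integral_nonneg fun z : Eucl d × Eucl d => abs_nonneg (L z.1 - L z.2)
  obtain ⟨hp, hfst, hsnd⟩ := hπ
  have i1 : Integrable (fun z : Eucl d × Eucl d => L z.1) π := by
    rw [← hfst] at hμ
    exact (integrable_map_measure hL.aestronglyMeasurable measurable_fst.aemeasurable).1 hμ
  have i2 : Integrable (fun z : Eucl d × Eucl d => L z.2) π := by
    rw [← hsnd] at hν
    exact (integrable_map_measure hL.aestronglyMeasurable measurable_snd.aemeasurable).1 hν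
  have m1 : ∀ t, ∫ θ, max (L θ - t) 0 ∂μ = ∫ z, max (L z.1 - t) 0 ∂π := fun t => by
    rw [← hfst, integral_map measurable_fst.aemeasurable
      (by fun_prop : Measurable fun θ => max (L θ - t) 0).aestronglyMeasurable]
  have m2 : ∀ t, ∫ θ, max (L θ - t) 0 ∂ν = ∫ z, max (L z.2 - t) 0 ∂π := fun t => by
    rw [← hsnd, integral_map measurable_snd.aemeasurable
      (by fun_prop : Measurable fun θ => max (L θ - t) 0).aestronglyMeasurable]
  have j1 : ∀ t, Integrable (fun z : Eucl d × Eucl d => max (L z.1 - t) 0) π := fun t =>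
    (i1.sub (integrable_const t)).pos_part
  have j2 : ∀ t, Integrable (fun z : Eucl d × Eucl d => max (L z.2 - t) 0) π := fun t =>
    (i2.sub (integrable_const t)).pos_part
  have k : ∀ t, |(∫ z, max (L z.1 - t) 0 ∂π) - ∫ z, max (L z.2 - t) 0 ∂π|
      ≤ ∫ z, |L z.1 - L z.2| ∂π := fun t => by
    rw [← integral_sub (j1 t) (j2 t)]
    refine abs_integral_le_integral_abs.trans
      (integral_mono ((j1 t).sub (j2 t)).abs (i1.sub i2).abs fun z => ?_)
    have := abs_max_sub_max_le_abs (L z.1 - t) (L z.2 - t) 0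
    simpa using this
  have a1 := integral_Ioo_quantile_eq hL hb μ hμ h0 h1
  have a2 := integral_Ioo_quantile_eq hL hb ν hν h0 h1
  have b1 := integral_Ioo_quantile_le hL hb μ hμ h0 h1 (quantile L ν b)
  have b2 := integral_Ioo_quantile_le hL hb ν hν h0 h1 (quantile L μ b)
  have k1 := abs_le.1 (k (quantile L ν b))
  have k2 := abs_le.1 (k (quantile L μ b))
  rw [m1] at a1 b1
  rw [m2] at a2 b2
  rw [abs_le]
  constructor <;> linarith [k1.1, k1.2, k2.1, k2.2]

/-- The factor 2 arises because the integral over `[a, b]` is a difference of two upper tails. -/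
theorem integral_quantile_sub_le {d : ℕ} {L : Eucl d → ℝ} (hL : Measurable L)
    (hb : BddBelow (range L)) {μ ν : Measure (Eucl d)} [IsProbabilityMeasure μ]
    [IsProbabilityMeasure ν] (hμ : Integrable L μ) (hν : Integrable L ν)
    {π : Measure (Eucl d × Eucl d)} (hπ : π ∈ couplings μ ν) {a b : ℝ} (h0 : 0 < a)
    (hab : a ≤ b) (h1 : b ≤ 1) :
    |(∫ s in a..b, quantile L μ s) - ∫ s in a..b, quantile L ν s|
      ≤ 2 * ∫ z, |L z.1 - L z.2| ∂π := by
  have key : ∀ (ρ : Measure (Eucl d)) [IsProbabilityMeasure ρ], Integrable L ρ →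
      ∫ s in a..b, quantile L ρ s
        = (∫ s in Ioo a 1, quantile L ρ s) - ∫ s in Ioo b 1, quantile L ρ s := by
    intro ρ _ hρ
    have i1 := intervalIntegrable_quantile hL hb ρ hρ h0.le hab h1
    have i2 := intervalIntegrable_quantile hL hb ρ hρ (h0.le.trans hab) h1 le_rfl
    have := intervalIntegral.integral_add_adjacent_intervals i1 i2
    rw [← integral_Ioc_eq_integral_Ioo, ← integral_Ioc_eq_integral_Ioo,
      ← intervalIntegral.integral_of_le (hab.trans h1), ← intervalIntegral.integral_of_le h1]
    linarith
  rw [key μ hμ, key ν hν]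
  have k1 := abs_le.1 (integral_Ioo_quantile_sub_le hL hb hμ hν hπ h0 (hab.trans h1))
  have k2 := abs_le.1 (integral_Ioo_quantile_sub_le hL hb hμ hν hπ (h0.trans_le hab) h1)
  rw [abs_le]
  constructor <;> linarith [k1.1, k1.2, k2.1, k2.2]

/-! ### Moments, the Wasserstein distance and the threshold. -/

theorem IsP2.integrable_norm {d : ℕ} {μ : Measure (Eucl d)} (h : IsP2 μ) :
    Integrable (fun θ => ‖θ‖) μ := by
  have := h.prob
  refine ((integrable_const (1 : ℝ)).add h.moment).mono' (by fun_prop) (ae_of_all _ fun θ => ?_)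
  simp only [norm_norm, Pi.add_apply]
  nlinarith [sq_nonneg (‖θ‖ - 1), norm_nonneg θ]

theorem IsP2.integrable_of_lipschitz {d : ℕ} {μ : Measure (Eucl d)} (h : IsP2 μ)
    {L : Eucl d → ℝ} (hL : Continuous L) {C : ℝ} (hC : ∀ θ θ', |L θ - L θ'| ≤ C * ‖θ - θ'‖) :
    Integrable L μ := by
  have := h.prob
  refine ((integrable_const |L 0|).add (h.integrable_norm.const_mul C)).mono'
    hL.aestronglyMeasurable (ae_of_all _ fun θ => ?_)
  have h1 := hC θ 0
  have h2 := abs_add_le (L θ - L 0) (L 0)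
  simp only [sub_zero, sub_add_cancel, Pi.add_apply, Real.norm_eq_abs] at *
  linarith

theorem integrable_norm_sub_sq_of_mem_couplings {d : ℕ} {μ ν : Measure (Eucl d)} (hμ : IsP2 μ)
    (hν : IsP2 ν) {π : Measure (Eucl d × Eucl d)} (hπ : π ∈ couplings μ ν) :
    Integrable (fun z : Eucl d × Eucl d => ‖z.1 - z.2‖ ^ 2) π := by
  obtain ⟨hp, hfst, hsnd⟩ := hπ
  have i1 := hμ.moment
  have i2 := hν.moment
  rw [← hfst] at i1
  rw [← hsnd] at i2
  replace i1 := (integrable_map_measure i1.1 measurable_fst.aemeasurable).1 i1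
  replace i2 := (integrable_map_measure i2.1 measurable_snd.aemeasurable).1 i2
  refine ((i1.add i2).const_mul 2).mono' (by fun_prop) (ae_of_all _ fun z => ?_)
  simp only [Pi.add_apply, Function.comp_apply, norm_pow, norm_norm]
  have := norm_sub_le z.1 z.2
  nlinarith [sq_nonneg (‖z.1‖ - ‖z.2‖), norm_nonneg (z.1 - z.2), norm_nonneg z.1,
    norm_nonneg z.2]

theorem le_wasserstein2 {d : ℕ} {μ ν : Measure (Eucl d)} (hμ : IsP2 μ) (hν : IsP2 ν) {D : ℝ}
    (h : ∀ π ∈ couplings μ ν, D ≤ ∫ z, ‖z.1 - z.2‖ ∂π) : D ≤ wasserstein2 μ ν := by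
  rcases lt_or_ge D 0 with hD | hD
  · exact hD.le.trans (Real.sqrt_nonneg _)
  have := hμ.prob
  have := hν.prob
  refine Real.le_sqrt_of_sq_le ?_
  -- The product coupling has finite cost, so `toReal` does not collapse the infimum to 0.
  have hfin : (⨅ π ∈ couplings μ ν, ∫⁻ z, ENNReal.ofReal (‖z.1 - z.2‖ ^ 2) ∂π) ≠ ∞ := by
    have hmem : μ.prod ν ∈ couplings μ ν :=
      ⟨inferInstance, by simp [Measure.map_fst_prod], by simp [Measure.map_snd_prod]⟩
    refine ne_top_of_le_ne_top ?_ (iInf₂_le _ hmem)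
    have i := integrable_norm_sub_sq_of_mem_couplings hμ hν hmem
    rw [← ofReal_integral_eq_lintegral_ofReal i (ae_of_all _ fun z => by positivity)]
    exact ENNReal.ofReal_ne_top
  rw [← ENNReal.ofReal_le_iff_le_toReal hfin]
  refine le_iInf₂ fun π hπ => ?_
  have i := integrable_norm_sub_sq_of_mem_couplings hμ hν hπ
  have hp := hπ.1
  rw [← ofReal_integral_eq_lintegral_ofReal i (ae_of_all _ fun z => by positivity)]
  refine ENNReal.ofReal_le_ofReal ((pow_le_pow_left₀ hD (h π hπ) 2).trans ?_)
  have i1 : Integrable (fun z : Eucl d × Eucl d => ‖z.1 - z.2‖) π := by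
    refine ((integrable_const (1 : ℝ)).add i).mono' (by fun_prop) (ae_of_all _ fun z => ?_)
    simp only [norm_norm, Pi.add_apply]
    nlinarith [sq_nonneg (‖z.1 - z.2‖ - 1), norm_nonneg (z.1 - z.2)]
  set m := ∫ z, ‖z.1 - z.2‖ ∂π
  -- Jensen's inequality for the square, by its tangent line at the mean: `x ^ 2 ≥ 2 * m * x - m ^
  -- 2`.
  have hm : ∫ z, (2 * m * ‖z.1 - z.2‖ - m ^ 2) ∂π = m ^ 2 := by
    rw [integral_sub (i1.const_mul _) (integrable_const _), integral_const_mul]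
    simp only [integral_const, probReal_univ, one_smul]
    ring
  rw [← hm]
  refine integral_mono ((i1.const_mul _).sub (integrable_const _)) i fun z => ?_
  simp only
  nlinarith [sq_nonneg (‖z.1 - z.2‖ - m)]

/-- The threshold of the quantile set is Lipschitz in the Wasserstein distance. -/
theorem abs_threshold_sub_le {d : ℕ} {L : Eucl d → ℝ} (hL : Continuous L)
    (hb : BddBelow (range L)) {C : ℝ} (hC0 : 0 < C)
    (hC : ∀ θ θ', |L θ - L θ'| ≤ C * ‖θ - θ'‖) {β δ : ℝ} (hβ : 0 < β) (hβ1 : β ≤ 1)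
    {μ ν : Measure (Eucl d)} (hμ : IsP2 μ) (hν : IsP2 ν) :
    |(2 / β * (∫ a in (β / 2)..β, quantile L μ a) + δ)
        - (2 / β * (∫ a in (β / 2)..β, quantile L ν a) + δ)|
      ≤ 4 * C / β * wasserstein2 μ ν := by
  have := hμ.prob
  have := hν.prob
  set q := ∫ a in (β / 2)..β, quantile L μ a
  set q' := ∫ a in (β / 2)..β, quantile L ν a
  have key : |q - q'| / (2 * C) ≤ wasserstein2 μ ν := by
    refine le_wasserstein2 hμ hν fun π hπ => ?_
    have h1 := integral_quantile_sub_le hL.measurable hb (hμ.integrable_of_lipschitz hL hC)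
      (hν.integrable_of_lipschitz hL hC) hπ (a := β / 2) (b := β) (by linarith) (by linarith) hβ1
    have hp := hπ.1
    have i := integrable_norm_sub_sq_of_mem_couplings hμ hν hπ
    have i1 : Integrable (fun z : Eucl d × Eucl d => ‖z.1 - z.2‖) π := by
      refine ((integrable_const (1 : ℝ)).add i).mono' (by fun_prop) (ae_of_all _ fun z => ?_)
      simp only [norm_norm, Pi.add_apply]
      nlinarith [sq_nonneg (‖z.1 - z.2‖ - 1), norm_nonneg (z.1 - z.2)]
    have h2 : ∫ z, |L z.1 - L z.2| ∂π ≤ ∫ z, C * ‖z.1 - z.2‖ ∂π :=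
      integral_mono_of_nonneg (ae_of_all _ fun z => abs_nonneg _) (i1.const_mul C)
        (ae_of_all _ fun z => hC _ _)
    rw [integral_const_mul] at h2
    rw [div_le_iff₀ (by positivity)]
    linarith
  have e : (2 / β * q + δ) - (2 / β * q' + δ) = 2 / β * (q - q') := by ring
  rw [div_le_iff₀ (by positivity)] at key
  rw [e, abs_mul, abs_of_pos (by positivity : 0 < 2 / β)]
  calc 2 / β * |q - q'| ≤ 2 / β * (wasserstein2 μ ν * (2 * C)) := by gcongr
    _ = 4 * C / β * wasserstein2 μ ν := by ring

/-! ### Integrals against two densities over two sets. -/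

theorem volume_real_symmDiff_sublevel {d : ℕ} {L : Eucl d → ℝ} (hL : Continuous L) (R t t' : ℝ) :
    volume.real (symmDiff {θ | θ ∈ Metric.closedBall (0 : Eucl d) R ∧ L θ ≤ t}
        {θ | θ ∈ Metric.closedBall (0 : Eucl d) R ∧ L θ ≤ t'})
      = |volume.real {θ | θ ∈ Metric.closedBall (0 : Eucl d) R ∧ L θ ≤ t}
        - volume.real {θ | θ ∈ Metric.closedBall (0 : Eucl d) R ∧ L θ ≤ t'}| := by
  have hfin : ∀ s, volume {θ | θ ∈ Metric.closedBall (0 : Eucl d) R ∧ L θ ≤ s} ≠ ∞ := fun s =>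
    ne_top_of_le_ne_top (measure_closedBall_lt_top (μ := volume) (x := (0 : Eucl d)) (r := R)).ne
      (measure_mono fun θ hθ => hθ.1)
  have hmeas : ∀ s, MeasurableSet {θ | θ ∈ Metric.closedBall (0 : Eucl d) R ∧ L θ ≤ s} :=
    fun s => Metric.isClosed_closedBall.measurableSet.inter
      (measurableSet_le hL.measurable measurable_const)
  wlog h : t ≤ t' generalizing t t'
  · rw [symmDiff_comm, abs_sub_comm]
    exact this t' t (not_le.1 h).le
  have hsub : {θ | θ ∈ Metric.closedBall (0 : Eucl d) R ∧ L θ ≤ t}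
      ⊆ {θ | θ ∈ Metric.closedBall (0 : Eucl d) R ∧ L θ ≤ t'} :=
    fun θ hθ => ⟨hθ.1, hθ.2.trans h⟩
  have hle := measureReal_mono (μ := volume) hsub (hfin t')
  rw [symmDiff_of_le hsub, measureReal_sdiff hsub (hmeas t) (hfin t'), abs_sub_comm,
    abs_of_nonneg (sub_nonneg.2 hle)]

theorem setIntegral_densityMeasure {d : ℕ} {E : Type*} [NormedAddCommGroup E] [NormedSpace ℝ E]
    {ϱ : Eucl d → ℝ} (h : IsBoundedP2Density ϱ) {s : Set (Eucl d)} (hs : MeasurableSet s)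
    (g : Eucl d → E) :
    ∫ θ in s, g θ ∂(densityMeasure ϱ) = ∫ θ in s, ϱ θ • g θ := by
  rw [densityMeasure, setIntegral_withDensity_eq_setIntegral_toReal_smul₀
    (h.memLp_top.1.aemeasurable.ennreal_ofReal.restrict) (ae_of_all _ fun _ => ENNReal.ofReal_lt_top)
    g hs]
  refine integral_congr_ae ?_
  filter_upwards [ae_restrict_of_ae h.nonneg] with θ hθ
  rw [ENNReal.toReal_ofReal hθ]

/-- The bound is pointwise on `B`. On `s ∩ s'` only the densities differ; on `s' \ s` the integrand
is at most `M * Λ`; on `s \ s'` the triangle inequality passes from `ϱ` to `ϱ'`, so only one density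
enters through its sup bound. -/
theorem norm_setIntegral_sub_setIntegral_le {d : ℕ} {E : Type*} [NormedAddCommGroup E]
    [NormedSpace ℝ E] {ϱ ϱ' : Eucl d → ℝ}
    (h : IsBoundedP2Density ϱ) (h' : IsBoundedP2Density ϱ') {Λ M : ℝ}
    (hΛ : ∀ᵐ θ, |ϱ' θ| ≤ Λ) {B s s' : Set (Eucl d)} (hB : MeasurableSet B)
    (hBfin : volume B ≠ ∞) (hs : MeasurableSet s) (hs' : MeasurableSet s') (hsB : s ⊆ B)
    (hsB' : s' ⊆ B) {g : Eucl d → E} (hg : StronglyMeasurable g) (hM : ∀ θ ∈ B, ‖g θ‖ ≤ M)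
    (hM0 : 0 ≤ M) :
    ‖(∫ θ in s, g θ ∂(densityMeasure ϱ)) - ∫ θ in s', g θ ∂(densityMeasure ϱ')‖
      ≤ M * ((∫ θ in B, |ϱ θ - ϱ' θ|) + Λ * volume.real (symmDiff s s')) := by
  have : IsFiniteMeasure (volume.restrict B) := ⟨by simpa using hBfin.lt_top⟩
  have hint : ∀ {f : Eucl d → ℝ}, MemLp f ∞ volume → IntegrableOn f B := fun hf =>
    (hf.restrict B).integrable le_top
  have hintg : ∀ {f : Eucl d → ℝ}, MemLp f ∞ volume → IntegrableOn (fun θ => f θ • g θ) B := by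
    intro f hf
    refine ((hint hf).norm.mul_const M).mono'
      ((hf.1.restrict).smul hg.aestronglyMeasurable) ?_
    filter_upwards [ae_restrict_mem hB] with θ hθ
    rw [norm_smul]
    exact mul_le_mul_of_nonneg_left (hM θ hθ) (norm_nonneg _)
  have hdiff : IntegrableOn (fun θ => |ϱ θ - ϱ' θ|) B :=
    ((hint h.memLp_top).sub (hint h'.memLp_top)).abs
  have hΔ : MeasurableSet (symmDiff s s') := hs.symmDiff hs'
  have hΔB : symmDiff s s' ⊆ B := fun θ hθ => hθ.elim (fun k => hsB k.1) fun k => hsB' k.1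
  have hind : IntegrableOn ((symmDiff s s').indicator fun _ => Λ) B :=
    (integrable_const Λ).indicator hΔ
  have e : ∀ {t : Set (Eucl d)} (f : Eucl d → E), MeasurableSet t → t ⊆ B →
      ∫ θ in t, f θ = ∫ θ in B, t.indicator f θ := by
    intro t f ht htB
    rw [setIntegral_indicator ht, inter_eq_self_of_subset_right htB]
  have eΛ : ∫ θ in B, (symmDiff s s').indicator (fun _ => Λ) θ
      = Λ * volume.real (symmDiff s s') := by
    rw [setIntegral_indicator hΔ, inter_eq_self_of_subset_right hΔB, setIntegral_const,
      smul_eq_mul, mul_comm]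
  rw [setIntegral_densityMeasure h hs, setIntegral_densityMeasure h' hs', e _ hs hsB,
    e _ hs' hsB', ← integral_sub ((hintg h.memLp_top).indicator hs)
      ((hintg h'.memLp_top).indicator hs'), ← eΛ, ← integral_add hdiff hind, ← integral_const_mul]
  refine norm_integral_le_of_norm_le ((hdiff.add hind).const_mul M) ?_
  filter_upwards [ae_restrict_mem hB, ae_restrict_of_ae hΛ] with θ hθ hl
  have hgM := hM θ hθ
  have tri : |ϱ θ| ≤ |ϱ θ - ϱ' θ| + |ϱ' θ| := by
    simpa using abs_add_le (ϱ θ - ϱ' θ) (ϱ' θ)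
  by_cases k : θ ∈ s <;> by_cases k' : θ ∈ s'
  · have kk : θ ∉ symmDiff s s' := by simp [mem_symmDiff, k, k']
    simp only [indicator_of_mem k, indicator_of_mem k', indicator_of_notMem kk, ← sub_smul,
      norm_smul, Real.norm_eq_abs, add_zero]
    rw [mul_comm]
    gcongr
  · have kk : θ ∈ symmDiff s s' := by simp [mem_symmDiff, k, k']
    simp only [indicator_of_mem k, indicator_of_notMem k', indicator_of_mem kk, sub_zero,
      norm_smul, Real.norm_eq_abs]
    rw [mul_comm]
    gcongr
    linarith
  · have kk : θ ∈ symmDiff s s' := by simp [mem_symmDiff, k, k']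
    simp only [indicator_of_notMem k, indicator_of_mem k', indicator_of_mem kk, zero_sub,
      norm_neg, norm_smul, Real.norm_eq_abs]
    rw [mul_comm]
    gcongr
    linarith [abs_nonneg (ϱ θ - ϱ' θ)]
  · have kk : θ ∉ symmDiff s s' := by simp [mem_symmDiff, k, k']
    simp only [indicator_of_notMem k, indicator_of_notMem k', indicator_of_notMem kk, sub_zero,
      norm_zero, add_zero]
    positivity

theorem integral_abs_le_normL2Ball {d : ℕ} (R : ℝ) {f : Eucl d → ℝ} (hf : MemLp f ∞ volume) :
    ∫ θ in Metric.closedBall (0 : Eucl d) R, |f θ|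
      ≤ Real.sqrt (volume.real (Metric.closedBall (0 : Eucl d) R)) * normL2Ball R f := by
  have hfin : volume (Metric.closedBall (0 : Eucl d) R) ≠ ∞ := measure_closedBall_lt_top.ne
  have : IsFiniteMeasure (volume.restrict (Metric.closedBall (0 : Eucl d) R)) :=
    ⟨by simpa using hfin.lt_top⟩
  have h2 : MemLp f 2 (volume.restrict (Metric.closedBall (0 : Eucl d) R)) :=
    (hf.restrict _).mono_exponent le_top
  have h1 := eLpNorm_le_eLpNorm_mul_rpow_measure_univ (p := 1) (q := 2) (by norm_num) h2.1
  have e : ∫ θ in Metric.closedBall (0 : Eucl d) R, |f θ|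
      = (eLpNorm f 1 (volume.restrict (Metric.closedBall (0 : Eucl d) R))).toReal := by
    rw [eLpNorm_one_eq_lintegral_enorm, ← integral_norm_eq_lintegral_enorm h2.1]
    rfl
  have htop : eLpNorm f 2 (volume.restrict (Metric.closedBall (0 : Eucl d) R))
      * (volume.restrict (Metric.closedBall (0 : Eucl d) R)) univ
        ^ (1 / (1 : ℝ≥0∞).toReal - 1 / (2 : ℝ≥0∞).toReal) ≠ ∞ :=
    ENNReal.mul_ne_top h2.2.ne (ENNReal.rpow_ne_top_of_nonneg (by norm_num) (by simpa using hfin))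
  rw [e]
  refine (ENNReal.toReal_mono htop h1).trans (le_of_eq ?_)
  rw [ENNReal.toReal_mul, ← ENNReal.toReal_rpow, Measure.restrict_apply_univ, mul_comm, normL2Ball,
    Real.sqrt_eq_rpow, Measure.real]
  norm_num

/-! ### Stability of the consensus point as a quotient. -/

theorem consensusPoint_eq_smul {d : ℕ} (G L : Eucl d → ℝ) (α β δ R : ℝ) (μ : Measure (Eucl d)) :
    consensusPoint G L α β δ R μ
      = (∫ θ in quantileSet L β δ R μ, gibbsWeight G α θ ∂μ)⁻¹ •
        ∫ θ in quantileSet L β δ R μ, gibbsWeight G α θ • θ ∂μ := by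
  simp only [consensusPoint, restrictedMeasure, div_eq_inv_mul, mul_smul]
  rw [integral_smul]

/-- Since `z'⁻¹ • n'` has norm at most `R`, the error in the normalization is multiplied by `R`
only, and a single denominator remains. -/
theorem norm_inv_smul_sub_inv_smul_le {E : Type*} [NormedAddCommGroup E] [NormedSpace ℝ E]
    {z z' R ε : ℝ} {n n' : E} (hz : 0 < z) (hz' : 0 < z') (hn' : ‖n'‖ ≤ R * z')
    (hn : ‖n - n'‖ ≤ R * ε) (hzz : |z - z'| ≤ ε) :
    ‖z⁻¹ • n - z'⁻¹ • n'‖ ≤ 2 * R * ε / z := by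
  have e : z⁻¹ • n - z'⁻¹ • n' = z⁻¹ • ((n - n') - (z - z') • (z'⁻¹ • n')) := by
    have h1 : z⁻¹ • z • z'⁻¹ • n' = z'⁻¹ • n' := inv_smul_smul₀ hz.ne' _
    have h2 : z' • z'⁻¹ • n' = n' := smul_inv_smul₀ hz'.ne' _
    rw [sub_smul, h2, smul_sub, smul_sub, smul_sub, h1]
    abel
  have hm : ‖z'⁻¹ • n'‖ ≤ R := by
    rw [norm_smul, norm_inv, Real.norm_of_nonneg hz'.le, inv_mul_le_iff₀ hz', mul_comm]
    exact hn'
  rw [e, norm_smul, norm_inv, Real.norm_of_nonneg hz.le, inv_mul_le_iff₀ hz]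
  calc ‖(n - n') - (z - z') • (z'⁻¹ • n')‖
      ≤ ‖n - n'‖ + |z - z'| * ‖z'⁻¹ • n'‖ := by
        rw [← Real.norm_eq_abs, ← norm_smul]
        exact norm_sub_le _ _
    _ ≤ R * ε + ε * R := by
        have : 0 ≤ ε := (abs_nonneg _).trans hzz
        gcongr
    _ = z * (2 * R * ε / z) := by field_simp; ring

theorem norm_consensusPoint_sub_le {d : ℕ} {R c α β δ C₁ C_L C₄ Λ : ℝ} {L G : Eucl d → ℝ}
    (hR : 0 < R) (hc : 0 < c) (hα : 0 < α) (hβ : 0 < β) (hβ1 : β ≤ 1) (hC₁ : 0 < C₁)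
    (hC₄ : 0 < C₄) (hΛ0 : 0 ≤ Λ)
    (hA : Assumptions R C₁ C_L C₄ L G) {ϱ ϱ' : Eucl d → ℝ} (h : IsBoundedP2Density ϱ)
    (h' : IsBoundedP2Density ϱ') (hΛ : ∀ᵐ θ, |ϱ' θ| ≤ Λ)
    (hcμ : c ≤ (densityMeasure ϱ).real (quantileSet L β δ R (densityMeasure ϱ)))
    (hcν : c ≤ (densityMeasure ϱ').real (quantileSet L β δ R (densityMeasure ϱ'))) :
    ‖consensusPoint G L α β δ R (densityMeasure ϱ)
        - consensusPoint G L α β δ R (densityMeasure ϱ')‖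
      ≤ 2 * R / (Real.exp (-α * (C₄ * (1 + R ^ 2))) * c)
        * (Real.sqrt (volume.real (Metric.closedBall (0 : Eucl d) R))
            * normL2Ball R (fun θ => ϱ θ - ϱ' θ)
          + Λ * (|C_L| * (4 * C₁ / β
            * wasserstein2 (densityMeasure ϱ) (densityMeasure ϱ')))) := by
  have hLc := hA.continuous_L
  have hGc := hA.continuous_G
  set μ := densityMeasure ϱ
  set ν := densityMeasure ϱ'
  have hpμ : IsProbabilityMeasure μ := h.isP2.prob
  have hpν : IsProbabilityMeasure ν := h'.isP2.prob
  set B := Metric.closedBall (0 : Eucl d) R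
  set S := quantileSet L β δ R μ with hS
  set S' := quantileSet L β δ R ν with hS'
  set w := gibbsWeight G α with hw
  set m := ⨅ θ, G θ
  set E := Real.exp (-α * m)
  set e := Real.exp (-α * (C₄ * (1 + R ^ 2)))
  have hE : 0 < E := Real.exp_pos _
  have he : 0 < e := Real.exp_pos _
  have hBm : MeasurableSet B := Metric.isClosed_closedBall.measurableSet
  have hBfin : volume B ≠ ∞ := measure_closedBall_lt_top.ne
  have hmeas : ∀ ρ, MeasurableSet (quantileSet L β δ R ρ) := fun ρ =>
    hBm.inter (measurableSet_le hLc.measurable measurable_const)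
  have hsub : ∀ ρ, quantileSet L β δ R ρ ⊆ B := fun ρ θ hθ => hθ.1
  have hwc : Continuous w := by
    rw [hw]
    unfold gibbsWeight
    fun_prop
  have hw0 : ∀ θ, 0 < w θ := fun θ => Real.exp_pos _
  have hwE : ∀ θ, w θ ≤ E := fun θ => by
    refine Real.exp_le_exp.2 ?_
    nlinarith [ciInf_le hA.w4 θ]
  have hwe : ∀ θ ∈ B, E * e ≤ w θ := fun θ hθ => by
    rw [← Real.exp_add]
    refine Real.exp_le_exp.2 ?_
    have h1 := hA.w6 θ
    have h2 : ‖θ‖ ≤ R := by simpa [B] using hθ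
    have h3 : C₄ * (1 + ‖θ‖ ^ 2) ≤ C₄ * (1 + R ^ 2) := by gcongr
    have h4 : α * (G θ - m) ≤ α * (C₄ * (1 + R ^ 2)) := by gcongr; linarith
    linarith
  have hwi : ∀ (ρ : Measure (Eucl d)) [IsProbabilityMeasure ρ], Integrable w ρ := fun ρ _ =>
    (integrable_const E).mono' hwc.aestronglyMeasurable
      (ae_of_all _ fun θ => by rw [Real.norm_of_nonneg (hw0 θ).le]; exact hwE θ)
  have hZ : ∀ (ρ : Measure (Eucl d)) [IsProbabilityMeasure ρ],
      c ≤ ρ.real (quantileSet L β δ R ρ) →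
      E * e * c ≤ ∫ θ in quantileSet L β δ R ρ, w θ ∂ρ := fun ρ _ hρ => by
    calc E * e * c ≤ E * e * ρ.real (quantileSet L β δ R ρ) := by gcongr
      _ = ∫ θ in quantileSet L β δ R ρ, E * e ∂ρ := by
          rw [setIntegral_const, smul_eq_mul, mul_comm]
      _ ≤ ∫ θ in quantileSet L β δ R ρ, w θ ∂ρ :=
          setIntegral_mono_on (integrable_const _).integrableOn (hwi ρ).integrableOn (hmeas ρ)
            fun θ hθ => hwe θ (hsub ρ hθ)
  -- W3 only speaks of levels above `inf L`; a threshold with nonempty quantile set is such a level.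
  have hne : ∀ (ρ : Measure (Eucl d)), c ≤ ρ.real (quantileSet L β δ R ρ) →
      (2 / β * (∫ a in (β / 2)..β, quantile L ρ a) + δ) ∈ Ici (⨅ θ, L θ) := fun ρ hρ => by
    obtain ⟨θ, hθ⟩ : (quantileSet L β δ R ρ).Nonempty := by
      rw [nonempty_iff_ne_empty]
      intro h0
      rw [h0, measureReal_empty] at hρ
      linarith
    exact (ciInf_le hA.w1 θ).trans hθ.2
  have hΔ : volume.real (symmDiff S S') ≤ |C_L| * (4 * C₁ / β * wasserstein2 μ ν) := by
    refine (volume_real_symmDiff_sublevel hLc R _ _).le.trans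
      ((hA.w3 _ (hne μ hcμ) _ (hne ν hcν)).trans ?_)
    have := abs_threshold_sub_le (δ := δ) hLc hA.w1 hC₁ hA.w2 hβ hβ1 h.isP2 h'.isP2
    exact (mul_le_mul_of_nonneg_right (le_abs_self C_L) (abs_nonneg _)).trans
      (mul_le_mul_of_nonneg_left this (abs_nonneg _))
  set D := (∫ θ in B, |ϱ θ - ϱ' θ|) + Λ * volume.real (symmDiff S S')
  have hD : D ≤ Real.sqrt (volume.real B) * normL2Ball R (fun θ => ϱ θ - ϱ' θ)
      + Λ * (|C_L| * (4 * C₁ / β * wasserstein2 μ ν)) :=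
    add_le_add (integral_abs_le_normL2Ball R (h.memLp_top.sub h'.memLp_top))
      (mul_le_mul_of_nonneg_left hΔ hΛ0)
  have hD0 : 0 ≤ D := add_nonneg (integral_nonneg fun θ => abs_nonneg _)
    (mul_nonneg hΛ0 measureReal_nonneg)
  have hZd : |(∫ θ in S, w θ ∂μ) - ∫ θ in S', w θ ∂ν| ≤ E * D :=
    norm_setIntegral_sub_setIntegral_le h h' hΛ hBm hBfin (hmeas μ) (hmeas ν) (hsub μ) (hsub ν)
      hwc.stronglyMeasurable
      (fun θ _ => by rw [Real.norm_of_nonneg (hw0 θ).le]; exact hwE θ) hE.le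
  have hNd : ‖(∫ θ in S, w θ • θ ∂μ) - ∫ θ in S', w θ • θ ∂ν‖ ≤ R * (E * D) := by
    rw [← mul_assoc]
    refine norm_setIntegral_sub_setIntegral_le h h' hΛ hBm hBfin (hmeas μ) (hmeas ν) (hsub μ)
      (hsub ν) (hwc.smul continuous_id).stronglyMeasurable (fun θ hθ => ?_) (by positivity)
    have h2 : ‖θ‖ ≤ R := by simpa [B] using hθ
    rw [norm_smul, Real.norm_of_nonneg (hw0 θ).le, mul_comm]
    exact mul_le_mul h2 (hwE θ) (hw0 θ).le hR.le
  have hN' : ‖∫ θ in S', w θ • θ ∂ν‖ ≤ R * ∫ θ in S', w θ ∂ν := by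
    rw [← integral_const_mul]
    refine norm_integral_le_of_norm_le ((hwi ν).integrableOn.const_mul R) ?_
    filter_upwards [ae_restrict_mem (hmeas ν)] with θ hθ
    have h2 : ‖θ‖ ≤ R := by simpa [B] using hsub ν hθ
    rw [norm_smul, Real.norm_of_nonneg (hw0 θ).le, mul_comm]
    exact mul_le_mul_of_nonneg_right h2 (hw0 θ).le
  have hZμ := hZ μ hcμ
  have hZν := hZ ν hcν
  have hEec : 0 < E * e * c := by positivity
  rw [consensusPoint_eq_smul, consensusPoint_eq_smul]
  refine (norm_inv_smul_sub_inv_smul_le (hEec.trans_le hZμ) (hEec.trans_le hZν) hN' hNd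
    hZd).trans ?_
  -- The factor `E = exp (-α * inf G)` bounds the weight from above and also occurs in its lower
  -- bound, so it cancels and the constant does not depend on `inf G`.
  calc 2 * R * (E * D) / ∫ θ in S, w θ ∂μ ≤ 2 * R * (E * D) / (E * e * c) := by gcongr
    _ = 2 * R / (e * c) * D := by field_simp
    _ ≤ _ := by gcongr

theorem ae_abs_le_of_eLpNorm_top_le {X : Type*} [MeasurableSpace X] {μ : Measure X} {f : X → ℝ}
    {Λ : ℝ} (h : eLpNorm f ∞ μ ≤ ENNReal.ofReal Λ) : ∀ᵐ x ∂μ, |f x| ≤ max Λ 0 := by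
  rw [eLpNorm_exponent_top] at h
  filter_upwards [ae_le_eLpNormEssSup (f := f) (μ := μ)] with x hx
  have h1 := hx.trans h
  rw [Real.enorm_eq_ofReal_abs] at h1
  have h2 := ENNReal.toReal_mono ENNReal.ofReal_ne_top h1
  rwa [ENNReal.toReal_ofReal (abs_nonneg _), ENNReal.toReal_ofReal'] at h2

/-! ### The counterexample with three atoms. -/

/-- Mass `1/20` at the origin, `1/20` at `x` and `9/10` at `y`. -/
def threeAtoms {E : Type*} [MeasurableSpace E] (o x y : E) : Measure E :=
  ENNReal.ofReal (1 / 20) • Measure.dirac o + ENNReal.ofReal (1 / 20) • Measure.dirac x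
    + ENNReal.ofReal (9 / 10) • Measure.dirac y

section
variable {E : Type*} [MeasurableSpace E]

instance (o x y : E) : IsProbabilityMeasure (threeAtoms o x y) := by
  constructor
  simp only [threeAtoms, Measure.add_apply, Measure.smul_apply, measure_univ, smul_eq_mul, mul_one]
  rw [← ENNReal.ofReal_add (by norm_num) (by norm_num),
    ← ENNReal.ofReal_add (by norm_num) (by norm_num)]
  norm_num

theorem map_threeAtoms {F : Type*} [MeasurableSpace F] {f : E → F} (hf : Measurable f)
    (o x y : E) : (threeAtoms o x y).map f = threeAtoms (f o) (f x) (f y) := by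
  simp only [threeAtoms, Measure.map_add _ _ hf, Measure.map_smul, Measure.map_dirac' hf]

variable [MeasurableSingletonClass E]

theorem integrable_threeAtoms {V : Type*} [NormedAddCommGroup V] (o x y : E) (g : E → V) :
    Integrable g (threeAtoms o x y) :=
  (((integrable_dirac enorm_lt_top).smul_measure ENNReal.ofReal_ne_top).add_measure
    ((integrable_dirac enorm_lt_top).smul_measure ENNReal.ofReal_ne_top)).add_measure
    ((integrable_dirac enorm_lt_top).smul_measure ENNReal.ofReal_ne_top)

theorem integral_threeAtoms {V : Type*} [NormedAddCommGroup V] [NormedSpace ℝ V]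
    [CompleteSpace V] (o x y : E) (g : E → V) :
    ∫ z, g z ∂(threeAtoms o x y)
      = (1 / 20 : ℝ) • g o + (1 / 20 : ℝ) • g x + (9 / 10 : ℝ) • g y := by
  have i : ∀ (c : ℝ) (z : E), Integrable g (ENNReal.ofReal c • Measure.dirac z) := fun c z =>
    (integrable_dirac enorm_lt_top).smul_measure ENNReal.ofReal_ne_top
  rw [threeAtoms, integral_add_measure ((i _ _).add_measure (i _ _)) (i _ _),
    integral_add_measure (i _ _) (i _ _)]
  simp only [integral_smul_measure, integral_dirac]
  rw [ENNReal.toReal_ofReal (by norm_num), ENNReal.toReal_ofReal (by norm_num)]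

theorem measureReal_threeAtoms (o x y : E) {A : Set E} (hA : MeasurableSet A) :
    (threeAtoms o x y).real A = 1 / 20 * A.indicator 1 o + 1 / 20 * A.indicator 1 x
      + 9 / 10 * A.indicator 1 y := by
  rw [← integral_indicator_one hA, integral_threeAtoms]
  simp

end

theorem isP2_threeAtoms {d : ℕ} (o x y : Eucl d) : IsP2 (threeAtoms o x y) :=
  ⟨inferInstance, integrable_threeAtoms _ _ _ _⟩

theorem wasserstein2_threeAtoms_le {d : ℕ} (o x x' y : Eucl d) :
    wasserstein2 (threeAtoms o x y) (threeAtoms o x' y) ≤ ‖x - x'‖ := by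
  -- The coupling keeps `o` and `y` fixed and moves only the atom `x` to `x'`.
  have hmem : threeAtoms (o, o) (x, x') (y, y)
      ∈ couplings (threeAtoms o x y) (threeAtoms o x' y) :=
    ⟨inferInstance, map_threeAtoms measurable_fst _ _ _, map_threeAtoms measurable_snd _ _ _⟩
  refine Real.sqrt_le_iff.2 ⟨norm_nonneg _, ?_⟩
  refine ENNReal.toReal_le_of_le_ofReal (by positivity) ((iInf₂_le _ hmem).trans ?_)
  rw [← ofReal_integral_eq_lintegral_ofReal (integrable_threeAtoms _ _ _ _)
    (ae_of_all _ fun z => by positivity), integral_threeAtoms]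
  refine ENNReal.ofReal_le_ofReal ?_
  simp only [sub_self, norm_zero, smul_eq_mul]
  nlinarith [sq_nonneg ‖x - x'‖]

theorem quantile_norm_threeAtoms {d : ℕ} {x y : Eucl d} (hxy : ‖x‖ < ‖y‖) {a : ℝ}
    (ha : 1 / 10 < a) (ha1 : a ≤ 1) : quantile (fun θ => ‖θ‖) (threeAtoms 0 x y) a = ‖y‖ := by
  have hm : ∀ q : ℝ, MeasurableSet {θ : Eucl d | ‖θ‖ ≤ q} := fun q =>
    measurableSet_le measurable_norm measurable_const
  have : {q : ℝ | a ≤ (threeAtoms 0 x y).real {θ | ‖θ‖ ≤ q}} = Ici ‖y‖ := by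
    ext q
    rw [mem_ofPred_eq, measureReal_threeAtoms _ _ _ (hm q), mem_Ici]
    constructor
    · intro hq
      by_contra! hlt
      have h1 : {θ : Eucl d | ‖θ‖ ≤ q}.indicator (1 : Eucl d → ℝ) y = 0 :=
        indicator_of_notMem (by simpa using hlt) _
      have h2 : ∀ z, {θ : Eucl d | ‖θ‖ ≤ q}.indicator (1 : Eucl d → ℝ) z ≤ 1 := fun z =>
        indicator_le_self' (by simp) z
      linarith [h2 0, h2 x]
    · intro hq
      have h1 : ∀ z : Eucl d, ‖z‖ ≤ q →
          {θ : Eucl d | ‖θ‖ ≤ q}.indicator (1 : Eucl d → ℝ) z = 1 := fun z hz =>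
        indicator_of_mem (by simpa using hz) _
      rw [h1 0 (by simpa using (norm_nonneg y).trans hq), h1 x (hxy.le.trans hq), h1 y hq]
      linarith
  rw [quantile, this, csInf_Ici]

/-- All levels in `[3/20, 3/10]` exceed the mass `1/10` of the two light atoms, so the threshold is
`‖y‖ + δ > R` and the condition on `L` is void in the ball. -/
theorem quantileSet_norm_threeAtoms {d : ℕ} {x y : Eucl d} {δ R : ℝ} (hδ : 0 < δ)
    (hxy : ‖x‖ < ‖y‖) (hR : R ≤ ‖y‖) :
    quantileSet (fun θ => ‖θ‖) (3 / 10) δ R (threeAtoms 0 x y) = Metric.closedBall 0 R := by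
  have hi : ∫ a in (3 / 10 / 2 : ℝ)..(3 / 10), quantile (fun θ => ‖θ‖) (threeAtoms 0 x y) a
      = 3 / 20 * ‖y‖ := by
    rw [intervalIntegral.integral_congr (g := fun _ => ‖y‖)]
    · rw [intervalIntegral.integral_const, smul_eq_mul]
      norm_num
    · intro a ha
      rw [uIcc_of_le (by norm_num)] at ha
      exact quantile_norm_threeAtoms hxy (by linarith [ha.1]) (by linarith [ha.2])
  ext θ
  simp only [quantileSet, hi, mem_ofPred_eq, and_iff_left_iff_imp, mem_closedBall_zero_iff]
  intro h
  linarith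

/-- The consensus point jumps when an atom leaves the ball of radius `R`. -/
theorem not_consensusPoint_lipschitz_wasserstein2 {d : ℕ} [Nontrivial (Eucl d)] {α δ R : ℝ}
    (hδ : 0 < δ) (hR : 0 < R) :
    ¬ ∃ C : ℝ, ∀ μ ν : Measure (Eucl d), IsP2 μ → IsP2 ν →
        0 < μ.real (quantileSet (fun θ => ‖θ‖) (3 / 10) δ R μ) →
        0 < ν.real (quantileSet (fun θ => ‖θ‖) (3 / 10) δ R ν) →
        ‖consensusPoint (fun θ => ‖θ‖) (fun θ => ‖θ‖) α (3 / 10) δ R μ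
            - consensusPoint (fun θ => ‖θ‖) (fun θ => ‖θ‖) α (3 / 10) δ R ν‖
          ≤ C * wasserstein2 μ ν := by
  rintro ⟨C, hC⟩
  obtain ⟨e, he⟩ := exists_norm_eq (Eucl d) zero_le_one
  have hnorm : ∀ r : ℝ, 0 ≤ r → ‖r • e‖ = r := fun r hr => by
    rw [norm_smul, he, mul_one, Real.norm_of_nonneg hr]
  have hBm : MeasurableSet (Metric.closedBall (0 : Eucl d) R) :=
    Metric.isClosed_closedBall.measurableSet
  have hy : (2 * R) • e ∉ Metric.closedBall (0 : Eucl d) R := by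
    rw [mem_closedBall_zero_iff, hnorm _ (by positivity)]
    linarith
  have h0 : (0 : Eucl d) ∈ Metric.closedBall (0 : Eucl d) R := by simp [hR.le]
  have hQ : ∀ r, 0 ≤ r → r < 2 * R → quantileSet (fun θ => ‖θ‖) (3 / 10) δ R
      (threeAtoms 0 (r • e) ((2 * R) • e)) = Metric.closedBall (0 : Eucl d) R := fun r hr hr' =>
    quantileSet_norm_threeAtoms hδ (by rwa [hnorm _ hr, hnorm _ (by positivity)])
      (by rw [hnorm _ (by positivity)]; linarith)
  have hpos : ∀ r, 0 ≤ r → r < 2 * R → 0 < (threeAtoms 0 (r • e) ((2 * R) • e)).real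
      (quantileSet (fun θ => ‖θ‖) (3 / 10) δ R (threeAtoms 0 (r • e) ((2 * R) • e))) := by
    intro r hr hr'
    rw [hQ r hr hr', measureReal_threeAtoms _ _ _ hBm, indicator_of_mem h0]
    have h2 : ∀ z, 0 ≤ (Metric.closedBall (0 : Eucl d) R).indicator (1 : Eucl d → ℝ) z :=
      fun z => indicator_nonneg (by simp) z
    have h3 := h2 (r • e)
    have h4 := h2 ((2 * R) • e)
    simp only [Pi.one_apply]
    linarith
  set w := Real.exp (-α * R)
  have hw : 0 < w := Real.exp_pos _
  have hin : consensusPoint (fun θ => ‖θ‖) (fun θ => ‖θ‖) α (3 / 10) δ R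
      (threeAtoms 0 (R • e) ((2 * R) • e)) = (w * R / (1 + w)) • e := by
    have hx : R • e ∈ Metric.closedBall (0 : Eucl d) R := by
      rw [mem_closedBall_zero_iff, hnorm _ hR.le]
    rw [consensusPoint_eq_smul, hQ R hR.le (by linarith), ← integral_indicator hBm,
      ← integral_indicator hBm, integral_threeAtoms, integral_threeAtoms,
      indicator_of_mem h0, indicator_of_mem h0, indicator_of_mem hx, indicator_of_mem hx,
      indicator_of_notMem hy, indicator_of_notMem hy]
    simp only [gibbsWeight, hnorm _ hR.le, norm_zero, mul_zero, Real.exp_zero, smul_zero,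
      smul_eq_mul, add_zero, zero_add, smul_smul]
    congr 1
    change (1 / 20 * 1 + 1 / 20 * w)⁻¹ * (1 / 20 * (w * R)) = _
    field_simp
  have hout : ∀ r, R < r → r < 2 * R → consensusPoint (fun θ => ‖θ‖) (fun θ => ‖θ‖) α (3 / 10) δ R
      (threeAtoms 0 (r • e) ((2 * R) • e)) = 0 := by
    intro r hr hr'
    have hx : r • e ∉ Metric.closedBall (0 : Eucl d) R := by
      rw [mem_closedBall_zero_iff, hnorm _ (by linarith)]
      linarith
    rw [consensusPoint_eq_smul, hQ r (by linarith) hr', ← integral_indicator hBm,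
      ← integral_indicator hBm, integral_threeAtoms, integral_threeAtoms,
      indicator_of_mem h0, indicator_of_mem h0, indicator_of_notMem hx, indicator_of_notMem hx,
      indicator_of_notMem hy, indicator_of_notMem hy]
    simp
  set κ := w * R / (1 + w)
  have hκ : 0 < κ := by positivity
  -- Moving the light atom from radius `R` to `R + ε` makes the consensus point jump from `κ • e` to
  -- 0; `max C 0` covers negative `C`.
  have key : ∀ ε, 0 < ε → ε < R → κ ≤ max C 0 * ε := by
    intro ε hε hεR
    have h1 := hC _ _ (isP2_threeAtoms 0 (R • e) ((2 * R) • e))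
      (isP2_threeAtoms 0 ((R + ε) • e) ((2 * R) • e)) (hpos R hR.le (by linarith))
      (hpos (R + ε) (by linarith) (by linarith))
    rw [hin, hout (R + ε) (by linarith) (by linarith), sub_zero, hnorm _ hκ.le] at h1
    refine h1.trans (mul_le_mul (le_max_left _ _) ?_ (Real.sqrt_nonneg _) (le_max_right _ _))
    refine (wasserstein2_threeAtoms_le _ _ _ _).trans ?_
    rw [← sub_smul, sub_add_cancel_left, neg_smul, norm_neg, hnorm _ hε.le]
  have hlim : Tendsto (fun ε : ℝ => max C 0 * ε) (𝓝[>] 0) (𝓝 0) := by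
    have : Tendsto (fun ε : ℝ => max C 0 * ε) (𝓝 0) (𝓝 (max C 0 * 0)) :=
      (continuous_const.mul continuous_id).tendsto 0
    rw [mul_zero] at this
    exact this.mono_left nhdsWithin_le_nhds
  refine hκ.not_ge (ge_of_tendsto hlim ?_)
  filter_upwards [Ioo_mem_nhdsGT hR] with ε hε
  exact key ε hε.1 hε.2

end CB2O

end

theorem mainTheorem3 :
    (∀ (d : ℕ) (R K c α β C₁ C_L C₄ Λ : ℝ),
      0 < R → 0 < c → 0 < α → 0 < β → β ≤ 1 → 0 < C₁ → 0 < C₄ →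
      ∃ C : ℝ, 0 < C ∧
        ∀ (δ : ℝ) (L G : CB2O.Eucl d → ℝ), 0 < δ → CB2O.Assumptions R C₁ C_L C₄ L G →
        ∀ ϱ ϱ' : CB2O.Eucl d → ℝ,
          CB2O.IsBoundedP2Density ϱ → CB2O.IsBoundedP2Density ϱ' →
          MeasureTheory.eLpNorm ϱ' ⊤ MeasureTheory.volume ≤ ENNReal.ofReal Λ →
          ∫ θ, ‖θ‖ ^ 2 ∂(CB2O.densityMeasure ϱ) ≤ K →
          ∫ θ, ‖θ‖ ^ 2 ∂(CB2O.densityMeasure ϱ') ≤ K →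
          c ≤ (CB2O.densityMeasure ϱ).real
            (CB2O.quantileSet L β δ R (CB2O.densityMeasure ϱ)) →
          c ≤ (CB2O.densityMeasure ϱ').real
            (CB2O.quantileSet L β δ R (CB2O.densityMeasure ϱ')) →
          ‖CB2O.consensusPoint G L α β δ R (CB2O.densityMeasure ϱ)
              - CB2O.consensusPoint G L α β δ R (CB2O.densityMeasure ϱ')‖
            ≤ C * (CB2O.normL2Ball R (fun θ => ϱ θ - ϱ' θ)
              + CB2O.wasserstein2 (CB2O.densityMeasure ϱ) (CB2O.densityMeasure ϱ'))) ∧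
    (∀ α δ R : ℝ, 0 < α → 0 < δ → 0 < R →
      ¬ ∃ C : ℝ, ∀ μ ν : MeasureTheory.Measure (CB2O.Eucl 2),
        CB2O.IsP2 μ → CB2O.IsP2 ν →
        0 < μ.real (CB2O.quantileSet (fun θ => ‖θ‖) (3 / 10) δ R μ) →
        0 < ν.real (CB2O.quantileSet (fun θ => ‖θ‖) (3 / 10) δ R ν) →
        ‖CB2O.consensusPoint (fun θ => ‖θ‖) (fun θ => ‖θ‖) α (3 / 10) δ R μ
            - CB2O.consensusPoint (fun θ => ‖θ‖) (fun θ => ‖θ‖) α (3 / 10) δ R ν‖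
          ≤ C * CB2O.wasserstein2 μ ν) := by
  refine ⟨?_, fun α δ R _ hδ hR => CB2O.not_consensusPoint_lipschitz_wasserstein2 hδ hR⟩
  intro d R K c α β C₁ C_L C₄ Λ hR hc hα hβ hβ1 hC₁ hC₄
  set A := 2 * R / (Real.exp (-α * (C₄ * (1 + R ^ 2))) * c)
  set V := Real.sqrt (MeasureTheory.volume.real (Metric.closedBall (0 : CB2O.Eucl d) R))
  set B := max Λ 0 * (|C_L| * (4 * C₁ / β))
  have hA : 0 < A := by positivity
  have hV : 0 ≤ V := Real.sqrt_nonneg _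
  have hB : 0 ≤ B := by positivity
  -- The summand 1 makes the constant positive when only `0 ≤ V` and `0 ≤ B` are known; `max Λ 0`
  -- and `|C_L|` in `B` allow for either sign.
  refine ⟨A * (V + B) + 1, by positivity, ?_⟩
  intro δ L G _ hLG ϱ ϱ' h h' hΛ _ _ hcμ hcν
  refine (CB2O.norm_consensusPoint_sub_le hR hc hα hβ hβ1 hC₁ hC₄ (le_max_right Λ 0) hLG h h'
    (CB2O.ae_abs_le_of_eLpNorm_top_le hΛ) hcμ hcν).trans ?_
  set n := CB2O.normL2Ball R (fun θ => ϱ θ - ϱ' θ)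
  set W := CB2O.wasserstein2 (CB2O.densityMeasure ϱ) (CB2O.densityMeasure ϱ')
  have hn : 0 ≤ n := ENNReal.toReal_nonneg
  have hW : 0 ≤ W := Real.sqrt_nonneg _
  calc A * (V * n + max Λ 0 * (|C_L| * (4 * C₁ / β * W))) = A * (V * n + B * W) := by ring
    _ ≤ A * (V * n + B * W) + (A * (V * W + B * n) + (n + W)) :=
        le_add_of_nonneg_right (by positivity)
    _ = (A * (V + B) + 1) * (n + W) := by ring
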